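/- Let $d\ge 1$, let $\mathcal M^d$ be the space of probability measures on the nearest neighbours $\{\pm e_i\}_{i=1}^d$ of the origin of $\mathbb Z^d$, and let $\Omega=(\mathcal M^d)^{\mathbb Z^d}$ with the product $\sigma$-algebra; for $\omega\in\Omega$, $\omega(z,e)$ denotes the probability that the walk in the environment $\omega$ jumps from $z$ to $z+e$. Let $P=\nu^{\mathbb Z^d}$ for some probability measure $\nu$ on $\mathcal M^d$, and assume that for $P$-almost every $\omega$: (balanced) $\omega(z,e)=\omega(z,-e)$ for every $z\in\mathbb Z^d$ and every neighbour $e$ of the origin; and (genuinely $d$-dimensional) for every neighbour $e$ of the origin there is $z\in\mathbb Z^d$ with $\omega(z,e)>0$. Let $(\tau_x\omega)(z)=\omega(z-x)$ for $x,z\in\mathbb Z^d$. The environment viewed from the particle is the Markov chain on $\Omega$ which jumps from $\omega$ to $\tau_{-e}\omega$ with probability $\omega(0,e)$, i.e. it has the transition kernel $K(\omega,\cdot)=\sum_{e}\omega(0,e)\,\delta_{\tau_{-e}\omega}$. A probability measure $Q$ on $\Omega$ is stationary if $QK=Q$, and a stationary $Q$ is ergodic if $Q(A)\in\{0,1\}$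 for every measurable $A\subseteq\Omega$ such that $K(\omega,A)=\mathbf 1_A(\omega)$ for $Q$-almost every $\omega$. Then there are only finitely many probability measures on $\Omega$ that are stationary and ergodic for the environment viewed from the particle and absolutely continuous with respect to $P$. Furthermore, every probability measure $Q$ on $\Omega$ that is stationary for the environment viewed from the particle and absolutely continuous with respect to $P$ is a convex combination of these ergodic measures. -/

import Mathlib

open MeasureTheory ProbabilityTheory
open scoped ENNReal NNReal

/-- The `2 d` nearest neighbours `± e_i` of the origin of `ℤ^d`, coded by a coordinate `i` and
a sign. -/
abbrev Dir (d : ℕ) : Type := Fin d × ℤˣ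

/-- The vector `± e_i ∈ ℤ^d` of a direction. -/
def Dir.vec {d : ℕ} (e : Dir d) : Fin d → ℤ := Pi.single e.1 (e.2 : ℤ)

/-- The opposite direction. -/
def Dir.opp {d : ℕ} (e : Dir d) : Dir d := (e.1, -e.2)

/-- The space of all probability measures (probability vectors) on the nearest neighbours of the
origin, with the Borel structure inherited from `ℝ^(2d)`. -/
abbrev JumpLaw (d : ℕ) : Type := stdSimplex ℝ (Dir d)

/-- Environments: a jump law at each site of `ℤ^d`, with the product σ-algebra. -/
abbrev Env (d : ℕ) : Type := (Fin d → ℤ) → JumpLaw d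

/-- The probability `ω(z, e)` to jump from `z` to `z + e` in the environment `ω`. -/
def Env.prob {d : ℕ} (ω : Env d) (z : Fin d → ℤ) (e : Dir d) : ℝ := (ω z).1 e

/-- The shift `(τ_x ω)(z) = ω(z - x)`; thus `τ_{-x} ω` is the environment seen from `x`. -/
def Env.shift {d : ℕ} (x : Fin d → ℤ) (ω : Env d) : Env d := fun z => ω (z - x)

/-- The environment is balanced: `ω(z, e) = ω(z, -e)` for all `z` and `e`. -/
def Env.IsBalanced {d : ℕ} (ω : Env d) : Prop :=
  ∀ (z : Fin d → ℤ) (e : Dir d), ω.prob z e = ω.prob z e.opp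

/-- The environment is genuinely `d`-dimensional: each direction is allowed at some site. -/
def Env.IsGenuinelyDimensional {d : ℕ} (ω : Env d) : Prop :=
  ∀ e : Dir d, ∃ z : Fin d → ℤ, 0 < ω.prob z e

/-- The law `P = ν^{ℤ^d}` of an i.i.d. environment with single-site law `ν`. -/
noncomputable def iidEnv {d : ℕ} (ν : Measure (JumpLaw d)) [IsProbabilityMeasure ν] :
    Measure (Env d) :=
  Measure.infinitePi fun _ : Fin d → ℤ => ν

theorem Env.measurable_shift {d : ℕ} (x : Fin d → ℤ) :
    Measurable (Env.shift x : Env d → Env d) :=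
  measurable_pi_lambda _ fun z => measurable_pi_apply (z - x)

theorem Env.measurable_prob {d : ℕ} (z : Fin d → ℤ) (e : Dir d) :
    Measurable fun ω : Env d => ω.prob z e :=
  (measurable_pi_apply e).comp (measurable_subtype_coe.comp (measurable_pi_apply z))

/-- The transition kernel of the environment viewed from the particle: the law of
`τ_{-X_1} ω`, where `X_1` is the first step of the walk started at `0`, so that
`ω ↦ τ_{-e} ω` with probability `ω(0, e)`. -/
noncomputable def envKernel (d : ℕ) : Kernel (Env d) (Env d) where
  toFun ω := ∑ e : Dir d, ENNReal.ofReal (ω.prob 0 e) • Measure.dirac (Env.shift (-e.vec) ω)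
  measurable' := by
    refine Measure.measurable_of_measurable_coe _ fun A hA => ?_
    simp only [Measure.coe_finsetSum, Finset.sum_apply, Measure.smul_apply, smul_eq_mul]
    refine Finset.measurable_sum _ fun e _ => ?_
    refine (Env.measurable_prob 0 e).ennreal_ofReal.mul ?_
    exact (Measure.measurable_coe hA).comp
      (Measure.measurable_dirac.comp (Env.measurable_shift _))

/-- `Q` is a stationary probability measure of the environment viewed from the particle. -/
def IsEnvStationary {d : ℕ} (Q : Measure (Env d)) : Prop :=
  IsProbabilityMeasure Q ∧ (envKernel d).Invariant Q

/-- Ergodicity of `Q` with respect to the environment viewed from the particle: each measurable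
set `A` that is invariant for the chain, `Q`-almost surely `K(ω, A) = 1_A(ω)`, has
`Q`-measure `0` or `1`. -/
def IsEnvErgodic {d : ℕ} (Q : Measure (Env d)) : Prop :=
  ∀ A : Set (Env d), MeasurableSet A →
    (∀ᵐ ω ∂Q, envKernel d ω A = A.indicator (fun _ => (1 : ℝ≥0∞)) ω) → Q A = 0 ∨ Q A = 1

/-! A stationary `Q ≪ P` with density `f` lives on `B = {f > 0}`, which the chain almost surely
cannot leave. In a typical environment `ω`, the sites `z` with `τ_{-z} ω ∈ B` therefore form a set
closed under the possible steps, and ergodicity of the shifts makes it nonempty. Mutually singular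
stationary measures give disjoint closed sets, so it suffices to bound the expected number of these.

Let `x` be a point of a closed set nearest to the origin and `i` a coordinate with `|x i|` maximal.
Balance permits every usable coordinate to be moved in the sign pointing towards the origin. Such
moves raise the squared norm by at most `k ^ 2` in `k` steps, whereas a move of coordinate `i` would
lower it by `2 |x i| - 1`. By minimality no path of this kind can change coordinate `i` during about
`√|x i|` steps (`Env.IsBalanced.mem_stuck_of_minimal`). The path meets fresh sites only, so this has
probability at most `q ^ √|x i|` with `q < 1` (`iidEnv_stuck_le`), which is summable over `x`. The
sum bounds the number of singular stationary measures (`exists_card_mutuallySingular_le`).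

Distinct ergodic measures are mutually singular, hence finite in number. A stationary measure that
is not ergodic splits along an invariant set, and the bound forces the splitting to end
(`exists_eq_sum_ergodic`). -/

instance iidEnv.instIsProbabilityMeasure {d : ℕ} (ν : Measure (JumpLaw d))
    [IsProbabilityMeasure ν] : IsProbabilityMeasure (iidEnv ν) := by
  unfold iidEnv; infer_instance

/-! ### Shifts and independence of i.i.d. environments -/

theorem measurePreserving_shift {d : ℕ} (ν : Measure (JumpLaw d)) [IsProbabilityMeasure ν]
    (x : Fin d → ℤ) : MeasurePreserving (Env.shift x) (iidEnv ν) (iidEnv ν) :=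
  ⟨Env.measurable_shift x, Measure.map_infinitePi_infinitePi_of_inj
    (P := fun _ : Fin d → ℤ => ν) (f := fun z : Fin d → ℤ => z - x) sub_left_injective⟩

theorem Env.shift_shift {d : ℕ} (x y : Fin d → ℤ) (ω : Env d) :
    Env.shift x (Env.shift y ω) = Env.shift (x + y) ω := by
  funext z
  simp [Env.shift, sub_sub]

theorem Env.shift_zero {d : ℕ} (ω : Env d) : Env.shift 0 ω = ω := by
  funext z
  simp [Env.shift]

/-- The σ-algebra on environments generated by the sites in `T`. -/
abbrev siteSigma {d : ℕ} (T : Set (Fin d → ℤ)) : MeasurableSpace (Env d) :=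
  ⨆ z ∈ T, MeasurableSpace.comap (fun ω : Env d => ω z) inferInstance

theorem siteSigma_mono {d : ℕ} {S T : Set (Fin d → ℤ)} (h : S ⊆ T) :
    siteSigma S ≤ siteSigma T :=
  biSup_mono h

theorem siteSigma_le {d : ℕ} (T : Set (Fin d → ℤ)) :
    siteSigma T ≤ (inferInstance : MeasurableSpace (Env d)) :=
  iSup₂_le fun z _ => (measurable_pi_apply z).comap_le

theorem measurable_eval_siteSigma {d : ℕ} {T : Set (Fin d → ℤ)} {z : Fin d → ℤ} (hz : z ∈ T) :
    Measurable[siteSigma T] (fun ω : Env d => ω z) :=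
  Measurable.of_comap_le
    (le_iSup₂_of_le (f := fun z (_ : z ∈ T) =>
      MeasurableSpace.comap (fun ω : Env d => ω z) inferInstance) z hz le_rfl)

theorem measurable_prob_siteSigma {d : ℕ} {T : Set (Fin d → ℤ)} {z : Fin d → ℤ} (hz : z ∈ T)
    (e : Dir d) : Measurable[siteSigma T] (fun ω : Env d => ω.prob z e) :=
  ((measurable_pi_apply e).comp measurable_subtype_coe).comp (measurable_eval_siteSigma hz)

theorem iidEnv_inter_eq_mul {d : ℕ} (ν : Measure (JumpLaw d)) [IsProbabilityMeasure ν]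
    {S T : Set (Fin d → ℤ)} (hST : Disjoint S T) {A B : Set (Env d)}
    (hA : MeasurableSet[siteSigma S] A) (hB : MeasurableSet[siteSigma T] B) :
    iidEnv ν (A ∩ B) = iidEnv ν A * iidEnv ν B := by
  have h : iIndepFun (fun (z : Fin d → ℤ) (ω : Env d) => ω z) (iidEnv ν) :=
    iIndepFun_infinitePi (P := fun _ : Fin d → ℤ => ν) (X := fun _ ω => ω)
      (fun _ => measurable_id)
  exact (Indep_iff _ _ _).1
    (indep_iSup_of_disjoint (fun z => (measurable_pi_apply z).comap_le) h hST) A B hA hB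

theorem measurableSet_siteSigma_cylinder {d : ℕ} (F : Finset (Fin d → ℤ))
    {S : Set (F → JumpLaw d)} (hS : MeasurableSet S) (x : Fin d → ℤ) :
    MeasurableSet[siteSigma ((fun z => z - x) '' (F : Set (Fin d → ℤ)))]
      (Env.shift x ⁻¹' cylinder F S) := by
  have : Measurable[siteSigma ((fun z => z - x) '' (F : Set (Fin d → ℤ)))]
      (fun (ω : Env d) (z : F) => ω (z - x)) := by
    refine @measurable_pi_lambda _ _ _ (_) _ _ fun z => ?_
    exact measurable_eval_siteSigma ⟨z, z.2, rfl⟩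
  exact this hS

theorem exists_shift_disjoint {d : ℕ} (hd : 0 < d) (F : Finset (Fin d → ℤ)) :
    ∃ x : Fin d → ℤ, Disjoint (F : Set (Fin d → ℤ)) ((fun z => z - x) '' (F : Set _)) := by
  classical
  have : Nonempty (Fin d) := ⟨⟨0, hd⟩⟩
  obtain ⟨x, hx⟩ := Infinite.exists_notMem_finset ((F ×ˢ F).image fun p => p.1 - p.2)
  refine ⟨x, Set.disjoint_left.2 ?_⟩
  rintro _ hz ⟨w, hw, rfl⟩
  refine hx (Finset.mem_image.2 ⟨(w, w - x), Finset.mem_product.2 ⟨hw, hz⟩, ?_⟩)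
  simp

/-- The shifts act ergodically on an i.i.d. environment. -/
theorem iidEnv_eq_one_of_shift_invariant {d : ℕ} (hd : 0 < d) (ν : Measure (JumpLaw d))
    [IsProbabilityMeasure ν] {A : Set (Env d)} (hA : MeasurableSet A)
    (hinv : ∀ x, Env.shift x ⁻¹' A = A) (hpos : iidEnv ν A ≠ 0) : iidEnv ν A = 1 := by
  set P := iidEnv ν
  -- Mixing: a cylinder `C` that is `ε`-close to `A` is independent of a distant translate `D`,
  -- which is `ε`-close to the same `A`. Hence `P A` is nearly `P A * P A`.
  have key : ∀ ε : ℝ, 0 < ε → |P.real A - P.real A * P.real A| ≤ 4 * ε := by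
    intro ε hε
    obtain ⟨C, hC, hCA⟩ := exists_measure_symmDiff_lt_of_generateFrom_isSetRing (μ := P)
      (isSetRing_measurableCylinders (α := fun _ : Fin d → ℤ => JumpLaw d))
      ⟨{Set.univ}, by simp, by simpa using univ_mem_measurableCylinders (fun _ : Fin d → ℤ => JumpLaw d), by simp⟩
      generateFrom_measurableCylinders.symm hA (ENNReal.ofReal_pos.2 hε)
    obtain ⟨F, S, hS, rfl⟩ := (mem_measurableCylinders _).1 hC
    obtain ⟨x, hx⟩ := exists_shift_disjoint hd F
    set C : Set (Env d) := cylinder (α := fun _ => JumpLaw d) F S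
    have hCm : MeasurableSet C := MeasurableSet.of_mem_measurableCylinders hC
    set D := Env.shift x ⁻¹' C
    have hDm : MeasurableSet D := Env.measurable_shift x hCm
    have hC0 : MeasurableSet[siteSigma (F : Set (Fin d → ℤ))] C := by
      have h := measurableSet_siteSigma_cylinder F hS 0
      have h0 : (fun z : Fin d → ℤ => z - 0) '' (F : Set (Fin d → ℤ)) = F := by simp
      have h1 : Env.shift (0 : Fin d → ℤ) ⁻¹' C = C := by
        ext ω; rw [Set.mem_preimage, Env.shift_zero]
      rwa [h0, h1] at h
    have hmul : P.real (C ∩ D) = P.real C * P.real D :=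
      (congrArg ENNReal.toReal (iidEnv_inter_eq_mul ν hx hC0
        (measurableSet_siteSigma_cylinder F hS x))).trans ENNReal.toReal_mul
    have hPD : P.real D = P.real C := by
      simp only [measureReal_def, P, D]
      rw [(measurePreserving_shift ν x).measure_preimage hCm.nullMeasurableSet]
    have hCA' : P.real (symmDiff C A) ≤ ε := ENNReal.toReal_le_of_le_ofReal hε.le hCA.le
    have hDA' : P.real (symmDiff D A) ≤ ε := by
      have : symmDiff D A = Env.shift x ⁻¹' (symmDiff C A) := by
        rw [Set.preimage_symmDiff, hinv]
      rw [this, measureReal_def,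
        (measurePreserving_shift ν x).measure_preimage (hCm.symmDiff hA).nullMeasurableSet]
      exact hCA'
    have h1 : |P.real C - P.real A| ≤ ε :=
      (abs_measureReal_sub_le_measureReal_symmDiff hCm.nullMeasurableSet hA.nullMeasurableSet).trans hCA'
    have h2 : |P.real (C ∩ D) - P.real A| ≤ 2 * ε := by
      refine (abs_measureReal_sub_le_measureReal_symmDiff
        (hCm.inter hDm).nullMeasurableSet hA.nullMeasurableSet).trans ?_
      have : symmDiff (C ∩ D) A ⊆ symmDiff C A ∪ symmDiff D A := by
        intro ω
        simp only [Set.mem_symmDiff, Set.mem_union, Set.mem_inter_iff]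
        tauto
      linarith [(measureReal_mono (μ := P) this).trans (measureReal_union_le _ _)]
    rw [hmul, hPD] at h2
    have h3 : 0 ≤ P.real C := measureReal_nonneg
    have h4 : 0 ≤ P.real A := measureReal_nonneg
    have h5 : P.real C ≤ 1 := measureReal_le_one
    have h6 : P.real A ≤ 1 := measureReal_le_one
    rw [abs_le] at *
    constructor <;> nlinarith
  have h0 : P.real A - P.real A * P.real A = 0 := by
    refine abs_eq_zero.1 (le_antisymm (le_of_forall_pos_le_add fun ε hε => ?_) (abs_nonneg _))
    linarith [key (ε / 4) (by linarith)]
  have h1 : P.real A ≠ 0 := by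
    rw [measureReal_def]
    exact (ENNReal.toReal_pos hpos (measure_ne_top _ _)).ne'
  have h2 : P.real A = 1 := by
    have : P.real A * (1 - P.real A) = 0 := by linarith
    rcases mul_eq_zero.1 this with h | h
    · exact absurd h h1
    · linarith
  rw [measureReal_def] at h2
  rwa [← ENNReal.toReal_eq_one_iff]

/-! ### Directed paths that cannot change a given coordinate -/

/-- In the environment no path of at most `n` sites started at `x`, whose steps are allowed and
go in the directions `σ j • e j`, visits a site at which coordinate `i` may be changed. -/
def Stuck {d : ℕ} (σ : Fin d → ℤˣ) (i : Fin d) : ℕ → (Fin d → ℤ) → Set (Env d)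
  | 0, _ => Set.univ
  | n + 1, x => {ω | ω.prob x (i, 1) = 0 ∧
      ∀ j, 0 < ω.prob x (j, 1) → ω ∈ Stuck σ i n (x + Dir.vec (j, σ j))}

/-- The half space of the sites reachable from `x` by steps `σ j • e j`, or farther. -/
def halfSpace {d : ℕ} (σ : Fin d → ℤˣ) (x : Fin d → ℤ) : Set (Fin d → ℤ) :=
  {z | ∑ j, (σ j : ℤ) * x j ≤ ∑ j, (σ j : ℤ) * z j}

theorem sum_mul_add_vec {d : ℕ} (σ : Fin d → ℤˣ) (x : Fin d → ℤ) (j : Fin d) :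
    ∑ k, (σ k : ℤ) * (x + Dir.vec (j, σ j)) k = ∑ k, (σ k : ℤ) * x k + 1 := by
  simp [Dir.vec, mul_add, Finset.sum_add_distrib, Pi.single_apply, ← Units.val_mul,
    Int.units_mul_self]

theorem halfSpace_add_vec_subset {d : ℕ} (σ : Fin d → ℤˣ) (x : Fin d → ℤ) (j : Fin d) :
    halfSpace σ (x + Dir.vec (j, σ j)) ⊆ halfSpace σ x := by
  intro z hz
  simp only [halfSpace, Set.mem_ofPred_eq, sum_mul_add_vec] at hz ⊢
  linarith

theorem disjoint_singleton_halfSpace {d : ℕ} (σ : Fin d → ℤˣ) (x : Fin d → ℤ) (j : Fin d) :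
    Disjoint {x} (halfSpace σ (x + Dir.vec (j, σ j))) := by
  simp only [Set.disjoint_singleton_left, halfSpace, Set.mem_ofPred_eq, sum_mul_add_vec]
  linarith

theorem measurableSet_siteSigma_stuck {d : ℕ} (σ : Fin d → ℤˣ) (i : Fin d) (n : ℕ) :
    ∀ x, MeasurableSet[siteSigma (halfSpace σ x)] (Stuck σ i n x) := by
  induction n with
  | zero => intro x; exact @MeasurableSet.univ _ (_)
  | succ n ih =>
    intro x
    have hx : x ∈ halfSpace σ x := le_refl (∑ j, (σ j : ℤ) * x j)
    have : Stuck σ i (n + 1) x = (fun ω : Env d => ω.prob x (i, 1)) ⁻¹' {0} ∩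
        ⋂ j, ((fun ω : Env d => ω.prob x (j, 1)) ⁻¹' (Set.Iic 0) ∪
          Stuck σ i n (x + Dir.vec (j, σ j))) := by
      ext ω
      simp [Stuck, imp_iff_not_or]
    rw [this]
    refine @MeasurableSet.inter _ (_) _ _
      (measurable_prob_siteSigma hx _ (measurableSet_singleton _)) ?_
    refine @MeasurableSet.iInter _ _ (_) _ _ fun j => ?_
    exact @MeasurableSet.union _ (_) _ _ (measurable_prob_siteSigma hx _ measurableSet_Iic)
      (siteSigma_mono (halfSpace_add_vec_subset σ x j) _ (ih _))

theorem measurableSet_stuck {d : ℕ} (σ : Fin d → ℤˣ) (i : Fin d) (n : ℕ) (x : Fin d → ℤ) :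
    MeasurableSet (Stuck σ i n x) :=
  siteSigma_le _ _ (measurableSet_siteSigma_stuck σ i n x)

theorem Env.prob_nonneg {d : ℕ} (ω : Env d) (z : Fin d → ℤ) (e : Dir d) : 0 ≤ ω.prob z e :=
  (ω z).2.1 e

theorem Env.IsBalanced.exists_prob_pos {d : ℕ} {ω : Env d} (h : ω.IsBalanced)
    (z : Fin d → ℤ) : ∃ j, 0 < ω.prob z (j, 1) := by
  by_contra! hneg
  have h0 : ∀ j, ω.prob z (j, 1) = 0 := fun j => le_antisymm (hneg j) (ω.prob_nonneg z _)
  have h1 : ∑ e, ω.prob z e = 1 := (ω z).2.2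
  have h2 : ∀ e : Dir d, ω.prob z e = 0 := by
    rintro ⟨j, s⟩
    rcases Int.units_eq_one_or s with rfl | rfl
    · exact h0 j
    · rw [h z (j, -1)]
      simpa [Dir.opp] using h0 j
  simp [h2] at h1

theorem Env.IsBalanced.prob_pos {d : ℕ} {ω : Env d} (h : ω.IsBalanced)
    {z : Fin d → ℤ} {j : Fin d} (hj : 0 < ω.prob z (j, 1)) (s : ℤˣ) : 0 < ω.prob z (j, s) := by
  rcases Int.units_eq_one_or s with rfl | rfl
  · exact hj
  · rw [h z (j, -1)]
    simpa [Dir.opp] using hj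

/-- It is enough to follow one path, which always moves the least usable coordinate. The event `G j`
that this coordinate is `j` and that `i` is blocked depends on the site `x` alone. What follows
depends on a half space avoiding `x`, so each step contributes an independent factor, at most `q` in
total over the disjoint `G j`. -/
theorem iidEnv_stuck_le {d : ℕ} (ν : Measure (JumpLaw d)) [IsProbabilityMeasure ν]
    (hbal : ∀ᵐ ω ∂(iidEnv ν), Env.IsBalanced ω) {q : ℝ≥0∞}
    (hq : ∀ x i, iidEnv ν {ω | ω.prob x (i, 1) = 0} ≤ q) (σ : Fin d → ℤˣ) (i : Fin d) (n : ℕ) :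
    ∀ x, iidEnv ν (Stuck σ i n x) ≤ q ^ n := by
  induction n with
  | zero => intro x; simp [Stuck]
  | succ n ih =>
    intro x
    let G : Fin d → Set (Env d) := fun j => (fun ω : Env d => ω.prob x (i, 1)) ⁻¹' {0} ∩
      ((fun ω : Env d => ω.prob x (j, 1)) ⁻¹' Set.Ioi 0 ∩
        ⋂ k : Set.Iio j, (fun ω : Env d => ω.prob x (k, 1)) ⁻¹' Set.Iic 0)
    have hG : ∀ j, MeasurableSet[siteSigma {x}] (G j) := by
      intro j
      have hm := fun e => measurable_prob_siteSigma (d := d) (Set.mem_singleton x) e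
      refine @MeasurableSet.inter _ (_) _ _ (hm _ (measurableSet_singleton _)) ?_
      refine @MeasurableSet.inter _ (_) _ _ (hm _ measurableSet_Ioi) ?_
      exact @MeasurableSet.iInter _ _ (_) _ _ fun k => hm _ measurableSet_Iic
    have hdisj : Pairwise fun j k => Disjoint (G j) (G k) := by
      have aux : ∀ j k, j < k → Disjoint (G j) (G k) := fun j k hjk =>
        Set.disjoint_left.2 fun ω h1 h2 =>
          absurd (show 0 < ω.prob x (j, 1) from h1.2.1) (not_lt.2 (Set.mem_iInter.1 h2.2.2 ⟨j, hjk⟩))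
      intro j k hjk
      rcases lt_or_gt_of_ne hjk with h | h
      · exact aux j k h
      · exact (aux k j h).symm
    calc iidEnv ν (Stuck σ i (n + 1) x)
        ≤ iidEnv ν (⋃ j, G j ∩ Stuck σ i n (x + Dir.vec (j, σ j))) := by
          refine measure_mono_ae ?_
          filter_upwards [hbal] with ω hω hst
          obtain ⟨j, hj, hmin⟩ := WellFounded.has_min (wellFounded_lt (α := Fin d))
            {j | 0 < ω.prob x (j, 1)} (hω.exists_prob_pos x)
          refine Set.mem_iUnion.2 ⟨j, ⟨hst.1, hj, Set.mem_iInter.2 fun k => ?_⟩, hst.2 j hj⟩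
          exact not_lt.1 fun hk : 0 < ω.prob x (k, 1) => hmin k hk k.2
      _ ≤ ∑ j, iidEnv ν (G j ∩ Stuck σ i n (x + Dir.vec (j, σ j))) :=
          measure_iUnion_fintype_le _ _
      _ = ∑ j, iidEnv ν (G j) * iidEnv ν (Stuck σ i n (x + Dir.vec (j, σ j))) :=
          Finset.sum_congr rfl fun j _ => iidEnv_inter_eq_mul ν
            (disjoint_singleton_halfSpace σ x j) (hG j) (measurableSet_siteSigma_stuck _ _ _ _)
      _ ≤ ∑ j, iidEnv ν (G j) * q ^ n := Finset.sum_le_sum fun j _ => by gcongr; exact ih _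
      _ = iidEnv ν (⋃ j, G j) * q ^ n := by
          rw [← Finset.sum_mul, measure_iUnion hdisj fun j => siteSigma_le _ _ (hG j),
            tsum_fintype]
      _ ≤ q * q ^ n := by
          gcongr
          refine (measure_mono ?_).trans (hq x i)
          exact Set.iUnion_subset fun j ω hω => hω.1
      _ = q ^ (n + 1) := (pow_succ' q n).symm

/-- By shift invariance the probability does not depend on `x`. Were it one for some `i`, almost
surely direction `i` would be blocked at all sites, against genuine `d`-dimensionality. Then `q` is
a maximum over finitely many `i`. -/
theorem exists_lt_one_iidEnv_prob_eq_zero_le {d : ℕ} (ν : Measure (JumpLaw d))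
    [IsProbabilityMeasure ν] (hdim : ∀ᵐ ω ∂(iidEnv ν), Env.IsGenuinelyDimensional ω) :
    ∃ q : ℝ≥0∞, q < 1 ∧ ∀ x (i : Fin d), iidEnv ν {ω | ω.prob x (i, 1) = 0} ≤ q := by
  have hm : ∀ (x : Fin d → ℤ) (i : Fin d), MeasurableSet {ω : Env d | ω.prob x (i, 1) = 0} :=
    fun x i => Env.measurable_prob x (i, 1) (measurableSet_singleton 0)
  have hshift : ∀ x i, iidEnv ν {ω | ω.prob x (i, 1) = 0} =
      iidEnv ν {ω | ω.prob 0 (i, 1) = 0} := by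
    intro x i
    rw [← (measurePreserving_shift ν (-x)).measure_preimage (hm 0 i).nullMeasurableSet]
    congr 1
    ext ω
    simp [Env.prob, Env.shift]
  refine ⟨Finset.univ.sup fun i => iidEnv ν {ω | ω.prob 0 (i, 1) = 0}, ?_, fun x i => ?_⟩
  · refine (Finset.sup_lt_iff (by simp)).2 fun i _ => lt_of_le_of_ne prob_le_one fun h1 => ?_
    have hall : ∀ᵐ ω ∂(iidEnv ν), ∀ x : Fin d → ℤ, ω.prob x (i, 1) = 0 := by
      refine ae_all_iff.2 fun x => ?_
      exact (mem_ae_iff_prob_eq_one (hm x i)).2 ((hshift x i).trans h1)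
    obtain ⟨ω, h2, h3⟩ := (hall.and hdim).exists
    obtain ⟨z, hz⟩ := h3 (i, 1)
    exact hz.ne' (h2 z)
  · rw [hshift]
    exact Finset.le_sup (f := fun i => iidEnv ν {ω : Env d | ω.prob 0 (i, 1) = 0})
      (Finset.mem_univ i)

/-! ### Closed sets and summable events at their nearest points -/

/-- `C` is closed under the steps that are possible in the environment `ω`. -/
def Env.IsClosedUnder {d : ℕ} (ω : Env d) (C : Set (Fin d → ℤ)) : Prop :=
  ∀ z ∈ C, ∀ e : Dir d, 0 < ω.prob z e → z + e.vec ∈ C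

theorem sum_sq_add_vec {d : ℕ} (y : Fin d → ℤ) (j : Fin d) (s : ℤˣ) :
    ∑ k, (y + Dir.vec (j, s)) k ^ 2 = ∑ k, y k ^ 2 + 2 * (s * y j) + 1 := by
  have hs : (s : ℤ) ^ 2 = 1 := by
    rcases Int.units_eq_one_or s with rfl | rfl <;> simp
  simp only [Dir.vec, Pi.add_apply, add_sq, Finset.sum_add_distrib, Pi.single_apply]
  simp [hs, mul_comm, mul_left_comm, mul_assoc]

/-- At a point of a closed set that is nearest to the origin, the paths that move towards the
origin in each coordinate until they pass it cannot change a large coordinate soon. -/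
theorem Env.IsBalanced.mem_stuck_of_minimal {d : ℕ} {ω : Env d} (hω : ω.IsBalanced)
    {C : Set (Fin d → ℤ)} (hC : ω.IsClosedUnder C) {x : Fin d → ℤ}
    (hmin : ∀ z ∈ C, ∑ j, x j ^ 2 ≤ ∑ j, z j ^ 2) {σ : Fin d → ℤˣ} {i : Fin d} {N : ℕ}
    (hN : (N : ℤ) ^ 2 ≤ -(σ i * x i)) (n : ℕ) :
    ∀ (k : ℕ) (y : Fin d → ℤ), k + n ≤ N → y ∈ C → ∑ j, y j ^ 2 ≤ ∑ j, x j ^ 2 + (k : ℤ) ^ 2 →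
      (∀ j, (σ j : ℤ) * y j ≤ k) → y i = x i → ω ∈ Stuck σ i n y := by
  induction n with
  | zero => intro k y _ _ _ _ _; trivial
  | succ n ih =>
    intro k y hk hy hsq hle hi
    -- Here `k` counts the steps already made. Moving coordinate `i` would give squared norm at most
    -- `|x|² + k² - 2N² + 1`, which is below the minimum `|x|²` because `k + 1 ≤ N`.
    have h0 : ω.prob y (i, 1) = 0 := by
      by_contra hne
      have hpos := hω.prob_pos (lt_of_le_of_ne (ω.prob_nonneg y _) (Ne.symm hne)) (σ i)
      have h1 := hmin _ (hC y hy _ hpos)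
      rw [sum_sq_add_vec, hi] at h1
      have hkN : (k : ℤ) + 1 ≤ N := by omega
      have hk0 : (0 : ℤ) ≤ k := by omega
      nlinarith
    refine ⟨h0, fun j hj => ih (k + 1) _ (by omega) (hC y hy _ (hω.prob_pos hj _)) ?_ ?_ ?_⟩
    -- One step adds `2 σ_j y_j + 1 ≤ 2k + 1`, exactly the increment from `k²` to `(k + 1)²`.
    · rw [sum_sq_add_vec]
      push_cast
      linarith [hle j]
    · intro l
      rcases eq_or_ne l j with rfl | hlj
      · have : (σ l : ℤ) * (σ l : ℤ) = 1 := by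
          rw [← Units.val_mul, Int.units_mul_self, Units.val_one]
        simp only [Dir.vec, Pi.add_apply, Pi.single_eq_same, mul_add, this]
        push_cast
        linarith [hle l]
      · simp only [Dir.vec, Pi.add_apply, Pi.single_eq_of_ne hlj, add_zero]
        push_cast
        linarith [hle l]
    · have hij : i ≠ j := by
        rintro rfl
        exact hj.ne' h0
      simp [Dir.vec, Pi.single_eq_of_ne hij, hi]

theorem summable_pow_box_mul_geometric (d : ℕ) {r : ℝ} (h0 : 0 ≤ r) (h1 : r < 1) :
    Summable fun s : ℕ => (2 * ((s : ℝ) + 1) ^ 2 + 1) ^ d * r ^ s := by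
  refine Summable.of_norm_bounded_eventually_nat
    (g := fun s : ℕ => 9 ^ d * ((s : ℝ) ^ (2 * d) * r ^ s)) ?_ ?_
  · have h := summable_pow_mul_geometric_of_norm_lt_one (r := r) (2 * d)
      (by rwa [Real.norm_of_nonneg h0])
    exact h.mul_left _
  · filter_upwards [Filter.eventually_ge_atTop 1] with s hs
    have hs' : (1 : ℝ) ≤ s := by exact_mod_cast hs
    have hb : 2 * ((s : ℝ) + 1) ^ 2 + 1 ≤ 9 * (s : ℝ) ^ 2 := by nlinarith
    rw [Real.norm_of_nonneg (mul_nonneg (pow_nonneg (by positivity) _) (pow_nonneg h0 _)),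
      pow_mul (s : ℝ), ← mul_assoc, ← mul_pow]
    exact mul_le_mul_of_nonneg_right (pow_le_pow_left₀ (by positivity) hb d) (pow_nonneg h0 s)

/-- The sites with `N x = s` lie in a box whose cardinality is polynomial in `s`, so grouping by the
value of `N` compares the sum with a polynomial times a geometric sequence. -/
theorem tsum_pow_lt_top {d : ℕ} {q : ℝ≥0∞} (hq : q < 1) {N : (Fin d → ℤ) → ℕ}
    (hN : ∀ x j, (x j).natAbs < (N x + 1) ^ 2) : ∑' x, q ^ N x < ∞ := by
  classical
  lift q to ℝ≥0 using hq.ne_top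
  have hq' : (q : ℝ) < 1 := by exact_mod_cast hq
  let Box : ℕ → Finset (Fin d → ℤ) := fun s =>
    Fintype.piFinset fun _ => Finset.Icc (-((s : ℤ) + 1) ^ 2) (((s : ℤ) + 1) ^ 2)
  have hmem : ∀ x, x ∈ Box (N x) := fun x => Fintype.mem_piFinset.2 fun j => by
    have : |x j| < ((N x : ℤ) + 1) ^ 2 := by
      rw [Int.abs_eq_natAbs]
      exact_mod_cast hN x j
    rw [abs_lt] at this
    exact Finset.mem_Icc.2 ⟨by linarith [this.1], this.2.le⟩
  have hcard : ∀ s, ((Box s).card : ℝ) = (2 * ((s : ℝ) + 1) ^ 2 + 1) ^ d := by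
    intro s
    have : (((s : ℤ) + 1) ^ 2 + 1 - -((s : ℤ) + 1) ^ 2).toNat = 2 * (s + 1) ^ 2 + 1 := by
      have : ((s : ℤ) + 1) ^ 2 + 1 - -((s : ℤ) + 1) ^ 2 = ((2 * (s + 1) ^ 2 + 1 : ℕ) : ℤ) := by
        push_cast; ring
      rw [this, Int.toNat_natCast]
    simp only [Box, Fintype.card_piFinset, Int.card_Icc, this, Finset.prod_const,
      Finset.card_univ, Fintype.card_fin]
    push_cast
    rfl
  calc ∑' x, (q : ℝ≥0∞) ^ N x
      = ∑' x, ∑' s, if s = N x then (q : ℝ≥0∞) ^ s else 0 := by simp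
    _ = ∑' s, ∑' x, if s = N x then (q : ℝ≥0∞) ^ s else 0 := ENNReal.tsum_comm
    _ ≤ ∑' s, ((Box s).card : ℝ≥0∞) * (q : ℝ≥0∞) ^ s := by
        refine ENNReal.tsum_le_tsum fun s => ?_
        have h0 : ∀ x ∉ Box s, (if s = N x then (q : ℝ≥0∞) ^ s else 0) = 0 := fun x hx =>
          if_neg fun h : s = N x => hx (h ▸ hmem x)
        rw [tsum_eq_sum h0, ← nsmul_eq_mul]
        refine Finset.sum_le_card_nsmul _ _ _ fun x _ => ?_
        split_ifs <;> simp
    _ = ∑' s, (((Box s).card * q ^ s : ℝ≥0) : ℝ≥0∞) := by push_cast; rfl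
    _ < ∞ := by
        rw [lt_top_iff_ne_top, ENNReal.tsum_coe_ne_top_iff_summable, ← NNReal.summable_coe]
        push_cast
        simp only [hcard]
        exact summable_pow_box_mul_geometric d q.2 hq'

/-- There are events, one for each site and with summable probabilities, such that each closed
set contains a site whose event occurs. -/
theorem exists_summable_events {d : ℕ} (hd : 0 < d) (ν : Measure (JumpLaw d))
    [IsProbabilityMeasure ν]
    (hP : ∀ᵐ ω ∂(iidEnv ν), Env.IsBalanced ω ∧ Env.IsGenuinelyDimensional ω) :
    ∃ E : (Fin d → ℤ) → Set (Env d), (∀ x, MeasurableSet (E x)) ∧ ∑' x, iidEnv ν (E x) < ∞ ∧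
      ∀ ω : Env d, ω.IsBalanced → ∀ C : Set (Fin d → ℤ), C.Nonempty → ω.IsClosedUnder C →
        ∃ x ∈ C, ω ∈ E x := by
  have : Nonempty (Fin d) := ⟨⟨0, hd⟩⟩
  obtain ⟨q, hq1, hq⟩ := exists_lt_one_iidEnv_prob_eq_zero_le ν (hP.mono fun _ h => h.2)
  choose i hi using fun x : Fin d → ℤ => Finite.exists_max fun j => (x j).natAbs
  -- The signs point towards the origin; the sign chosen for a vanishing coordinate is immaterial.
  let σ : (Fin d → ℤ) → Fin d → ℤˣ := fun x j => if 0 < x j then -1 else 1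
  have hσ : ∀ x j, (σ x j : ℤ) * x j = -|x j| := by
    intro x j
    by_cases h : 0 < x j
    · simp [σ, h, abs_of_pos h]
    · simp [σ, h, abs_of_nonpos (not_lt.1 h)]
  -- The square root balances two needs: `N² ≤ |x i|` for the minimality argument, and `|x j| < (N +
  -- 1)²` for all `j` for summability.
  let N : (Fin d → ℤ) → ℕ := fun x => Nat.sqrt (x (i x)).natAbs
  refine ⟨fun x => Stuck (σ x) (i x) (N x) x, fun x => measurableSet_stuck _ _ _ _, ?_, ?_⟩
  · refine (ENNReal.tsum_le_tsum fun x => iidEnv_stuck_le ν (hP.mono fun _ h => h.1) hq _ _ _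
      _).trans_lt (tsum_pow_lt_top hq1 fun x j => (hi x j).trans_lt ?_)
    rw [sq]
    exact Nat.lt_succ_sqrt _
  · intro ω hω C hne hC
    obtain ⟨x, hx, hmin⟩ := WellFounded.has_min
      (InvImage.wf (fun x : Fin d → ℤ => (∑ j, x j ^ 2).toNat) wellFounded_lt) C hne
    refine ⟨x, hx, hω.mem_stuck_of_minimal hC (fun z hz => ?_) ?_ (N x) 0 x (Nat.zero_add _).le hx
      (by simp) (fun j => by simp [hσ]) rfl⟩
    · have h : (∑ j, x j ^ 2).toNat ≤ (∑ j, z j ^ 2).toNat := not_lt.1 (hmin z hz)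
      have hz0 : 0 ≤ ∑ j, z j ^ 2 := Finset.sum_nonneg fun j _ => sq_nonneg _
      omega
    · rw [hσ, neg_neg, Int.abs_eq_natAbs]
      exact_mod_cast Nat.sqrt_le' _

/-! ### Invariant measures of Markov kernels and their densities -/

namespace ProbabilityTheory.Kernel

variable {α : Type*} [MeasurableSpace α] {K : Kernel α α} {μ ν : Measure α} {A : Set α}

theorem Invariant.lintegral_eq (h : K.Invariant μ) (hA : MeasurableSet A) :
    ∫⁻ ω, K ω A ∂μ = μ A := by
  rw [← Measure.bind_apply hA K.aemeasurable, h.def]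

/-- For an invariant measure, the flow out of a set equals the flow into it. -/
theorem Invariant.setLIntegral_compl_eq [IsMarkovKernel K] [IsFiniteMeasure μ]
    (h : K.Invariant μ) (hA : MeasurableSet A) :
    ∫⁻ ω in A, K ω Aᶜ ∂μ = ∫⁻ ω in Aᶜ, K ω A ∂μ := by
  have h1 : ∫⁻ ω in A, K ω A ∂μ + ∫⁻ ω in A, K ω Aᶜ ∂μ = μ A := by
    rw [← lintegral_add_left (K.measurable_coe hA)]
    simp [prob_add_prob_compl hA]
  have h2 : ∫⁻ ω in A, K ω A ∂μ + ∫⁻ ω in Aᶜ, K ω A ∂μ = μ A := by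
    rw [lintegral_add_compl _ hA, h.lintegral_eq hA]
  have hfin : ∫⁻ ω in A, K ω A ∂μ ≠ ∞ :=
    ne_top_of_le_ne_top (measure_ne_top μ A) (h1 ▸ le_self_add)
  exact (ENNReal.add_right_inj hfin).1 (h1.trans h2.symm)

/-- Nothing flows out of `A`, so by the balance of flows nothing flows in from `Aᶜ` either. -/
theorem Invariant.ae_eq_indicator [IsMarkovKernel K] [IsFiniteMeasure μ] (h : K.Invariant μ)
    (hA : MeasurableSet A) (hcl : ∀ᵐ ω ∂μ, ω ∈ A → K ω Aᶜ = 0) :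
    ∀ᵐ ω ∂μ, K ω A = A.indicator (fun _ => (1 : ℝ≥0∞)) ω := by
  have h0 : ∫⁻ ω in Aᶜ, K ω A ∂μ = 0 := by
    rw [← h.setLIntegral_compl_eq hA, lintegral_eq_zero_iff (K.measurable_coe hA.compl)]
    exact (ae_restrict_iff' hA).2 hcl
  rw [lintegral_eq_zero_iff (K.measurable_coe hA)] at h0
  filter_upwards [hcl, (ae_restrict_iff' hA.compl).1 h0] with ω h1 h2
  by_cases hω : ω ∈ A
  · rw [Set.indicator_of_mem hω]
    exact (prob_compl_eq_zero_iff hA).1 (h1 hω)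
  · rw [Set.indicator_of_notMem hω]
    exact h2 hω

/-- The mass that arrives in `E ∩ A` comes from `A` only, and from there `E` and `E ∩ A` are hit
with the same probability. -/
theorem Invariant.restrict [IsMarkovKernel K] (h : K.Invariant μ) (hA : MeasurableSet A)
    (hinv : ∀ᵐ ω ∂μ, K ω A = A.indicator (fun _ => (1 : ℝ≥0∞)) ω) :
    K.Invariant (μ.restrict A) := by
  refine Measure.ext fun E hE => ?_
  rw [Measure.bind_apply hE K.aemeasurable, Measure.restrict_apply hE,
    ← h.lintegral_eq (hE.inter hA), ← lintegral_indicator hA]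
  refine lintegral_congr_ae ?_
  filter_upwards [hinv] with ω hω
  by_cases hmem : ω ∈ A
  · rw [Set.indicator_of_mem hmem] at hω ⊢
    have h0 : K ω Aᶜ = 0 := (prob_compl_eq_zero_iff hA).2 hω
    exact (measure_inter_conull h0).symm
  · rw [Set.indicator_of_notMem hmem] at hω ⊢
    exact (measure_mono_null Set.inter_subset_right hω).symm

theorem ae_eq_indicator_compl [IsMarkovKernel K] (hA : MeasurableSet A)
    (hinv : ∀ᵐ ω ∂μ, K ω A = A.indicator (fun _ => (1 : ℝ≥0∞)) ω) :
    ∀ᵐ ω ∂μ, K ω Aᶜ = Aᶜ.indicator (fun _ => (1 : ℝ≥0∞)) ω := by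
  filter_upwards [hinv] with ω hω
  rw [prob_compl_eq_one_sub hA, hω]
  by_cases hmem : ω ∈ A <;> simp [hmem]

/-- The set where one invariant density exceeds another is closed for the chain. -/
theorem Invariant.ae_closed_of_density_lt [IsMarkovKernel K] {P : Measure α} {f g : α → ℝ≥0∞}
    (hf : Measurable f) (hg : Measurable g) [IsFiniteMeasure (P.withDensity f)]
    [IsFiniteMeasure (P.withDensity g)] (hKf : K.Invariant (P.withDensity f))
    (hKg : K.Invariant (P.withDensity g)) :
    ∀ᵐ ω ∂P, g ω < f ω → K ω {ω | g ω < f ω}ᶜ = 0 := by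
  set s := {ω | g ω < f ω}
  have hs : MeasurableSet s := measurableSet_lt hg hf
  have hk : Measurable fun ω => K ω sᶜ := K.measurable_coe hs.compl
  have hk' : Measurable fun ω => K ω s := K.measurable_coe hs
  -- Turn the outflow from `s` into the inflow from `sᶜ`, where `f ≤ g`, and turn back for `g`.
  -- Since `g < f` on `s`, the opposite inequality holds pointwise there, so the integrands agree
  -- almost everywhere and `K ω sᶜ` must vanish.
  have hin : ∫⁻ ω in s, f ω * K ω sᶜ ∂P ≤ ∫⁻ ω in s, g ω * K ω sᶜ ∂P := by
    have e1 := hKf.setLIntegral_compl_eq hs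
    have e2 := hKg.setLIntegral_compl_eq hs
    rw [restrict_withDensity hs, restrict_withDensity hs.compl,
      lintegral_withDensity_eq_lintegral_mul _ hf hk,
      lintegral_withDensity_eq_lintegral_mul _ hf hk'] at e1
    rw [restrict_withDensity hs, restrict_withDensity hs.compl,
      lintegral_withDensity_eq_lintegral_mul _ hg hk,
      lintegral_withDensity_eq_lintegral_mul _ hg hk'] at e2
    simp only [Pi.mul_apply] at e1 e2
    rw [e1, e2]
    refine setLIntegral_mono' hs.compl fun ω hω => ?_
    gcongr
    exact not_lt.1 hω
  have hfin : ∫⁻ ω in s, g ω * K ω sᶜ ∂P ≠ ∞ := by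
    refine ne_top_of_le_ne_top (measure_ne_top (P.withDensity g) s) ?_
    rw [withDensity_apply _ hs]
    exact lintegral_mono fun ω => mul_le_of_le_one_right' prob_le_one
  have hae := ae_eq_of_ae_le_of_lintegral_le (μ := P.restrict s)
    ((ae_restrict_iff' hs).2 (ae_of_all _ fun ω hω => by
      change g ω * K ω sᶜ ≤ f ω * K ω sᶜ
      gcongr
      exact le_of_lt hω)) hfin (hf.mul hk).aemeasurable hin
  filter_upwards [(ae_restrict_iff' hs).1 hae] with ω hω hlt
  by_contra hne
  exact hlt.ne ((ENNReal.mul_left_inj hne (measure_ne_top _ _)).1 (hω hlt))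

end ProbabilityTheory.Kernel

namespace MeasureTheory.Measure

theorem MutuallySingular.ae_rnDeriv_eq_zero {α : Type*} [MeasurableSpace α] {P μ ν : Measure α}
    [IsFiniteMeasure μ] [IsFiniteMeasure ν] [SigmaFinite P] (hμ : μ ≪ P) (hν : ν ≪ P)
    (h : μ ⟂ₘ ν) : ∀ᵐ ω ∂P, μ.rnDeriv P ω = 0 ∨ ν.rnDeriv P ω = 0 := by
  obtain ⟨t, -, h1, h2⟩ := h
  rw [← withDensity_rnDeriv_eq μ P hμ, withDensity_apply_eq_zero (measurable_rnDeriv _ _)] at h1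
  rw [← withDensity_rnDeriv_eq ν P hν, withDensity_apply_eq_zero (measurable_rnDeriv _ _)] at h2
  filter_upwards [measure_eq_zero_iff_ae_notMem.1 h1, measure_eq_zero_iff_ae_notMem.1 h2]
    with ω h3 h4
  by_contra! hne
  by_cases hω : ω ∈ t
  · exact h3 ⟨hne.1, hω⟩
  · exact h4 ⟨hne.2, hω⟩

end MeasureTheory.Measure

/-! ### Counting mutually singular stationary measures -/

theorem envKernel_apply {d : ℕ} (ω : Env d) {A : Set (Env d)} (hA : MeasurableSet A) :
    envKernel d ω A =
      ∑ e : Dir d, ENNReal.ofReal (ω.prob 0 e) * A.indicator 1 (Env.shift (-e.vec) ω) := by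
  change (∑ e : Dir d, ENNReal.ofReal (ω.prob 0 e) • Measure.dirac (Env.shift (-e.vec) ω)) A = _
  simp [Measure.coe_finsetSum, Measure.dirac_apply' _ hA]

instance envKernel.instIsMarkovKernel (d : ℕ) : IsMarkovKernel (envKernel d) := by
  refine ⟨fun ω => ⟨?_⟩⟩
  rw [envKernel_apply ω MeasurableSet.univ]
  have h1 : ∑ e, ω.prob 0 e = 1 := (ω 0).2.2
  simp [← ENNReal.ofReal_sum_of_nonneg fun e _ => ω.prob_nonneg 0 e, h1]

theorem mem_of_envKernel_compl_eq_zero {d : ℕ} {ω : Env d} {A : Set (Env d)}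
    (hA : MeasurableSet A) (h : envKernel d ω Aᶜ = 0) {e : Dir d} (he : 0 < ω.prob 0 e) :
    Env.shift (-e.vec) ω ∈ A := by
  rw [envKernel_apply ω hA.compl, Finset.sum_eq_zero_iff] at h
  by_contra hne
  have := h e (Finset.mem_univ e)
  rw [Set.indicator_of_mem (Set.mem_compl hne)] at this
  simp [not_le.2 he] at this

/-- The event that some translate lies in `B` is shift invariant and contains `B`, so ergodicity of
the shifts applies. -/
theorem iidEnv_ae_exists_shift_mem {d : ℕ} (hd : 0 < d) (ν : Measure (JumpLaw d))
    [IsProbabilityMeasure ν] {B : Set (Env d)} (hB : MeasurableSet B) (hpos : iidEnv ν B ≠ 0) :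
    ∀ᵐ ω ∂(iidEnv ν), ∃ z, Env.shift (-z) ω ∈ B := by
  have hm : MeasurableSet {ω : Env d | ∃ z, Env.shift (-z) ω ∈ B} := by
    simp only [Set.ofPred_exists]
    exact MeasurableSet.iUnion fun z => Env.measurable_shift (-z) hB
  refine (mem_ae_iff_prob_eq_one hm).2 (iidEnv_eq_one_of_shift_invariant hd ν hm ?_ ?_)
  · intro x
    ext ω
    simp only [Set.mem_preimage, Set.mem_ofPred_eq, Env.shift_shift]
    exact ⟨fun ⟨z, hz⟩ => ⟨z - x, by rwa [neg_sub, sub_eq_neg_add]⟩,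
      fun ⟨z, hz⟩ => ⟨z + x, by rwa [neg_add, neg_add_cancel_right]⟩⟩
  · refine fun h => hpos (measure_mono_null ?_ h)
    intro ω hω
    refine ⟨0, ?_⟩
    rwa [neg_zero, Env.shift_zero]

/-- The number of pairwise singular stationary measures that are absolutely continuous with
respect to the law of the environment is bounded. -/
theorem exists_card_mutuallySingular_le {d : ℕ} (hd : 0 < d) (ν : Measure (JumpLaw d))
    [IsProbabilityMeasure ν]
    (hP : ∀ᵐ ω ∂(iidEnv ν), Env.IsBalanced ω ∧ Env.IsGenuinelyDimensional ω) :
    ∃ M : ℕ, ∀ (ι : Type) [Fintype ι] (μ : ι → Measure (Env d)), (∀ i, IsFiniteMeasure (μ i)) →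
      (∀ i, μ i ≠ 0) → (∀ i, (envKernel d).Invariant (μ i)) → (∀ i, μ i ≪ iidEnv ν) →
      (Pairwise fun i j => μ i ⟂ₘ μ j) → Fintype.card ι ≤ M := by
  classical
  obtain ⟨E, hEm, hEsum, hE⟩ := exists_summable_events hd ν hP
  obtain ⟨M, hM⟩ := ENNReal.exists_nat_gt hEsum.ne
  refine ⟨M, fun ι _ μ hfin hne hinv hac hsing => ?_⟩
  set P := iidEnv ν
  have : IsProbabilityMeasure P := iidEnv.instIsProbabilityMeasure ν
  have : ∀ i, SFinite (μ i) := fun i => inferInstance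
  have : SigmaFinite P := inferInstance
  let f : ι → Env d → ℝ≥0∞ := fun i => (μ i).rnDeriv P
  have hfm : ∀ i, Measurable (f i) := fun i => Measure.measurable_rnDeriv _ _
  have hfd : ∀ i, P.withDensity (f i) = μ i := fun i => Measure.withDensity_rnDeriv_eq _ _ (hac i)
  let B : ι → Set (Env d) := fun i => {ω | 0 < f i ω}
  have hBm : ∀ i, MeasurableSet (B i) := fun i => measurableSet_lt measurable_const (hfm i)
  have hB0 : ∀ i, P (B i) ≠ 0 := by
    intro i h0
    apply hne i
    rw [← hfd i, withDensity_eq_zero_iff (hfm i).aemeasurable]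
    filter_upwards [measure_eq_zero_iff_ae_notMem.1 h0] with ω hω
    exact nonpos_iff_eq_zero.1 (not_lt.1 hω)
  have hclosed : ∀ i, ∀ᵐ ω ∂P, ω ∈ B i → envKernel d ω (B i)ᶜ = 0 := by
    intro i
    have : IsFiniteMeasure (P.withDensity (f i)) := by rw [hfd i]; infer_instance
    -- Closedness of `{0 < f i}` is the comparison of densities with the zero measure as second
    -- invariant measure.
    have : IsFiniteMeasure (P.withDensity fun _ => 0) := by
      rw [withDensity_const, zero_smul]; infer_instance
    refine Kernel.Invariant.ae_closed_of_density_lt (hfm i) measurable_const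
      (by rw [hfd i]; exact hinv i) ?_
    rw [withDensity_const, zero_smul]
    exact Measure.bind_zero_left _
  have hdisj : ∀ i j, i ≠ j → ∀ᵐ ω ∂P, ¬(ω ∈ B i ∧ ω ∈ B j) := by
    intro i j hij
    filter_upwards [(hsing hij).ae_rnDeriv_eq_zero (hac i) (hac j)] with ω hω ⟨h1, h2⟩
    exact hω.elim h1.ne' h2.ne'
  have hall : ∀ {p : Env d → Prop}, (∀ᵐ ω ∂P, p ω) → ∀ᵐ ω ∂P, ∀ z, p (Env.shift (-z) ω) :=
    fun h => ae_all_iff.2 fun z => (measurePreserving_shift ν (-z)).quasiMeasurePreserving.ae h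
  -- Each index gives a nonempty closed set of sites; these sets are disjoint, so the sites at which
  -- their events occur are distinct.
  have hcount : ∀ᵐ ω ∂P, (Fintype.card ι : ℝ≥0∞) ≤ ∑' x, (E x).indicator 1 ω := by
    filter_upwards [hP, ae_all_iff.2 fun i => hall (hclosed i),
      ae_all_iff.2 fun i => iidEnv_ae_exists_shift_mem hd ν (hBm i) (hB0 i),
      ae_all_iff.2 fun i => ae_all_iff.2 fun j => ae_all_iff.2 fun hij => hall (hdisj i j hij)]
      with ω hbal hcl hnonempty hdis
    have hx : ∀ i, ∃ x, Env.shift (-x) ω ∈ B i ∧ ω ∈ E x := by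
      intro i
      refine hE ω hbal.1 {x | Env.shift (-x) ω ∈ B i} (hnonempty i) fun z hz e he => ?_
      have he' : 0 < (Env.shift (-z) ω).prob 0 e := by simpa [Env.prob, Env.shift] using he
      have h := mem_of_envKernel_compl_eq_zero (hBm i) (hcl i z hz) he'
      rwa [Env.shift_shift, ← neg_add_rev] at h
    choose x hxB hxE using hx
    have hinj : Function.Injective x := by
      intro i j hij
      by_contra hne
      exact hdis i j hne (x i) ⟨hxB i, hij ▸ hxB j⟩
    calc (Fintype.card ι : ℝ≥0∞) = ∑ i, (E (x i)).indicator 1 ω := by simp [hxE]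
      _ = ∑ y ∈ Finset.univ.map ⟨x, hinj⟩, (E y).indicator 1 ω := by simp
      _ ≤ ∑' y, (E y).indicator 1 ω := ENNReal.sum_le_tsum _
  have hle : (Fintype.card ι : ℝ≥0∞) ≤ ∑' x, P (E x) := by
    calc (Fintype.card ι : ℝ≥0∞) = ∫⁻ _, (Fintype.card ι : ℝ≥0∞) ∂P := by simp
      _ ≤ ∫⁻ ω, ∑' x, (E x).indicator 1 ω ∂P := lintegral_mono_ae hcount
      _ = ∑' x, P (E x) := by
        rw [lintegral_tsum fun x => (measurable_one.indicator (hEm x)).aemeasurable]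
        exact tsum_congr fun x => lintegral_indicator_one (hEm x)
  exact_mod_cast (hle.trans_lt hM).le

/-! ### Ergodic measures and the decomposition -/

/-- The set `s` where the density of `Q` exceeds that of `R` is closed, hence invariant and trivial
for both measures. If `Q s = 0` then `Q ≤ R`, and if `R s = 1` then `R ≤ Q`; equal total mass turns
either into equality. In the remaining case `s` separates the two. -/
theorem IsEnvErgodic.eq_or_mutuallySingular {d : ℕ} {P Q R : Measure (Env d)} [SigmaFinite P]
    (hQ : IsEnvStationary Q) (hR : IsEnvStationary R) (hQe : IsEnvErgodic Q)
    (hRe : IsEnvErgodic R) (hQP : Q ≪ P) (hRP : R ≪ P) : Q = R ∨ Q ⟂ₘ R := by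
  obtain ⟨_, hQi⟩ := hQ
  obtain ⟨_, hRi⟩ := hR
  set f := Q.rnDeriv P
  set g := R.rnDeriv P
  have hf : Measurable f := Measure.measurable_rnDeriv _ _
  have hg : Measurable g := Measure.measurable_rnDeriv _ _
  have hfQ : P.withDensity f = Q := Measure.withDensity_rnDeriv_eq _ _ hQP
  have hgR : P.withDensity g = R := Measure.withDensity_rnDeriv_eq _ _ hRP
  have : IsFiniteMeasure (P.withDensity f) := by rw [hfQ]; infer_instance
  have : IsFiniteMeasure (P.withDensity g) := by rw [hgR]; infer_instance
  have hcl := Kernel.Invariant.ae_closed_of_density_lt (P := P) hf hg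
    (by rw [hfQ]; exact hQi) (by rw [hgR]; exact hRi)
  set s := {ω | g ω < f ω}
  have hs : MeasurableSet s := measurableSet_lt hg hf
  have hle : ∀ E, MeasurableSet E → Q (E ∩ sᶜ) ≤ R (E ∩ sᶜ) := by
    intro E hE
    rw [← hfQ, ← hgR, withDensity_apply _ (hE.inter hs.compl),
      withDensity_apply _ (hE.inter hs.compl)]
    exact setLIntegral_mono' (hE.inter hs.compl) fun ω hω => not_lt.1 hω.2
  have hge : ∀ E, MeasurableSet E → R (E ∩ s) ≤ Q (E ∩ s) := by
    intro E hE
    rw [← hfQ, ← hgR, withDensity_apply _ (hE.inter hs), withDensity_apply _ (hE.inter hs)]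
    exact setLIntegral_mono' (hE.inter hs) fun ω hω => le_of_lt hω.2
  rcases hQe s hs (hQi.ae_eq_indicator hs (hQP.ae_le hcl)) with h0 | h1
  · refine Or.inl (Measure.eq_of_le_of_measure_univ_eq (Measure.le_iff.2 fun E hE => ?_)
      (by simp))
    rw [← measure_inter_add_sdiff E hs, measure_mono_null Set.inter_subset_right h0, zero_add]
    exact (hle E hE).trans (measure_mono Set.inter_subset_left)
  · rcases hRe s hs (hRi.ae_eq_indicator hs (hRP.ae_le hcl)) with h2 | h2
    · exact Or.inr ⟨sᶜ, hs.compl, (prob_compl_eq_zero_iff hs).2 h1, by rwa [compl_compl]⟩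
    · refine Or.inl (Measure.eq_of_le_of_measure_univ_eq (Measure.le_iff.2 fun E hE => ?_)
        (by simp)).symm
      rw [← measure_inter_add_sdiff E hs,
        measure_mono_null (s := E \ s) (t := sᶜ) (fun ω hω => hω.2)
          ((prob_compl_eq_zero_iff hs).2 h2), add_zero]
      exact (hge E hE).trans (measure_mono Set.inter_subset_left)

theorem ProbabilityTheory.Kernel.Invariant.smul {α : Type*} [MeasurableSpace α] {K : Kernel α α} {μ : Measure α}
    (h : K.Invariant μ) (c : ℝ≥0∞) : K.Invariant (c • μ) := by
  refine Measure.ext fun E hE => ?_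
  rw [Measure.bind_apply hE K.aemeasurable, lintegral_smul_measure, h.lintegral_eq hE]
  rfl

/-- An invariant measure below which there are only boundedly many pairwise singular invariant
measures is a combination of ergodic ones. -/
theorem exists_eq_sum_ergodic {d : ℕ} {P : Measure (Env d)} (S : Finset (Measure (Env d)))
    (hS : ∀ Q, IsEnvStationary Q → IsEnvErgodic Q → Q ≪ P → Q ∈ S) (m : ℕ) :
    ∀ μ : Measure (Env d), IsFiniteMeasure μ → (envKernel d).Invariant μ → μ ≪ P →
      (∀ (ι : Type) [Fintype ι] (ρ : ι → Measure (Env d)), (∀ i, IsFiniteMeasure (ρ i)) →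
        (∀ i, ρ i ≠ 0) → (∀ i, (envKernel d).Invariant (ρ i)) → (∀ i, ρ i ≪ μ) →
        (Pairwise fun i j => ρ i ⟂ₘ ρ j) → Fintype.card ι ≤ m) →
      ∃ c : Measure (Env d) → ℝ≥0, μ = ∑ R ∈ S, c R • R := by
  classical
  induction m with
  -- The family consisting of `μ` alone already violates the bound unless `μ = 0`.
  | zero =>
    intro μ hfin hinv hac hμ
    refine ⟨0, ?_⟩
    by_contra hne
    have h := hμ Unit (fun _ => μ) (fun _ => hfin) (fun _ h => hne (by simpa using h))
      (fun _ => hinv) (fun _ => Measure.AbsolutelyContinuous.rfl)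
      (fun i j hij => absurd (Subsingleton.elim i j) hij)
    simp at h
  | succ m ih =>
    intro μ hfin hinv hac hμ
    rcases eq_or_ne μ 0 with rfl | hne
    · exact ⟨0, by simp⟩
    have hu0 : μ Set.univ ≠ 0 := by rwa [Ne, Measure.measure_univ_eq_zero]
    have hut : μ Set.univ ≠ ∞ := measure_ne_top μ _
    set Q : Measure (Env d) := (μ Set.univ)⁻¹ • μ
    have hQP : Q ≪ P := (Measure.smul_absolutelyContinuous).trans hac
    have hQ : IsEnvStationary Q :=
      ⟨⟨ENNReal.inv_mul_cancel hu0 hut⟩, hinv.smul _⟩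
    by_cases herg : IsEnvErgodic Q
    · refine ⟨Pi.single Q (μ Set.univ).toNNReal, ?_⟩
      rw [Finset.sum_eq_single_of_mem Q (hS Q hQ herg hQP)
        (fun R _ hR => by rw [Pi.single_eq_of_ne hR, zero_smul]), Pi.single_eq_same]
      refine Measure.ext fun E _ => ?_
      rw [Measure.smul_apply, ENNReal.smul_def, ENNReal.coe_toNNReal hut]
      change μ E = μ Set.univ * ((μ Set.univ)⁻¹ * μ E)
      rw [← mul_assoc, ENNReal.mul_inv_cancel hu0 hut, one_mul]
    · have hprob := hQ.1
      unfold IsEnvErgodic at herg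
      push Not at herg
      obtain ⟨A, hA, hAinv, hA0, hA1⟩ := herg
      have hμQ : μ ≪ Q := Measure.absolutelyContinuous_smul (ENNReal.inv_ne_zero.2 hut)
      have hAinv' := hμQ.ae_le hAinv
      have hcompl := Kernel.ae_eq_indicator_compl hA hAinv'
      have hμA : μ A ≠ 0 := fun h => hA0 (Measure.smul_absolutelyContinuous h)
      have hμA' : μ Aᶜ ≠ 0 := fun h => hA1 ((prob_compl_eq_zero_iff hA).1
        (Measure.smul_absolutelyContinuous h))
      -- A singular family below `μ.restrict B` can be enlarged by `μ.restrict Bᶜ`, so its size is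
      -- bounded by `m` instead of `m + 1`.
      have piece : ∀ B, MeasurableSet B → μ Bᶜ ≠ 0 → (envKernel d).Invariant (μ.restrict B) →
          (envKernel d).Invariant (μ.restrict Bᶜ) →
          ∃ c : Measure (Env d) → ℝ≥0, μ.restrict B = ∑ R ∈ S, c R • R := by
        intro B hB hB0 hBi hBci
        refine ih _ inferInstance hBi (Measure.absolutelyContinuous_of_le
          Measure.restrict_le_self |>.trans hac) fun ι _ ρ hρf hρ0 hρi hρac hρs => ?_
        have hle : ∀ D : Set (Env d), μ.restrict D ≪ μ := fun D =>
          Measure.absolutelyContinuous_of_le Measure.restrict_le_self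
        have hsing : ∀ i, ρ i ⟂ₘ μ.restrict Bᶜ := fun i =>
          ⟨Bᶜ, hB.compl, hρac i (by simp [Measure.restrict_apply hB.compl]),
            by simp [Measure.restrict_apply hB]⟩
        have h := hμ (Option ι) (fun o => o.elim (μ.restrict Bᶜ) ρ)
          (by rintro (_ | i); exacts [inferInstanceAs (IsFiniteMeasure (μ.restrict Bᶜ)), hρf i])
          (by
            rintro (_ | i)
            · exact fun h => hB0 (Measure.restrict_eq_zero.1 h)
            · exact hρ0 i)
          (by rintro (_ | i); exacts [hBci, hρi i])
          (by rintro (_ | i); exacts [hle _, (hρac i).trans (hle _)])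
          (by
            rintro (_ | i) (_ | j) hij
            · exact absurd rfl hij
            · exact (hsing j).symm
            · exact hsing i
            · exact hρs fun h => hij (congrArg some h))
        rw [Fintype.card_option] at h
        omega
      have hr := hinv.restrict hA hAinv'
      have hrc := hinv.restrict hA.compl hcompl
      obtain ⟨c₁, h₁⟩ := piece A hA hμA' hr hrc
      obtain ⟨c₂, h₂⟩ := piece Aᶜ hA.compl (by rwa [compl_compl]) hrc (by rwa [compl_compl])
      refine ⟨c₁ + c₂, ?_⟩
      simp only [Pi.add_apply, add_smul, Finset.sum_add_distrib]
      rw [← h₁, ← h₂, Measure.restrict_add_restrict_compl hA]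

theorem mainTheorem10 (d : ℕ) (ν : Measure (JumpLaw d)) [IsProbabilityMeasure ν]
    (hP : ∀ᵐ ω ∂(iidEnv ν), Env.IsBalanced ω ∧ Env.IsGenuinelyDimensional ω) :
    ∃ S : Finset (Measure (Env d)),
      (∀ Q : Measure (Env d), Q ∈ S ↔ IsEnvStationary Q ∧ IsEnvErgodic Q ∧ Q ≪ iidEnv ν) ∧
      ∀ Q : Measure (Env d), IsEnvStationary Q → Q ≪ iidEnv ν →
        ∃ c : Measure (Env d) → ℝ≥0, ∑ R ∈ S, c R = 1 ∧ Q = ∑ R ∈ S, c R • R := by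
  -- For `d = 0` there are no directions, and an empty sum cannot be `1`, so no jump law exists.
  have hd : 0 < d := by
    rcases Nat.eq_zero_or_pos d with rfl | h
    · obtain ⟨x⟩ := nonempty_of_isProbabilityMeasure ν
      have h1 : ∑ e, x.1 e = 1 := x.2.2
      simp at h1
    · exact h
  obtain ⟨M, hM⟩ := exists_card_mutuallySingular_le hd ν hP
  have hfin : {Q : Measure (Env d) |
      IsEnvStationary Q ∧ IsEnvErgodic Q ∧ Q ≪ iidEnv ν}.Finite := by
    by_contra hinf
    obtain ⟨t, ht, hcard⟩ := Set.Infinite.exists_subset_card_eq hinf (M + 1)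
    have h := hM t (fun Q => Q.1) (fun Q => have := (ht Q.2).1.1; inferInstance)
      (fun Q => have := (ht Q.2).1.1; IsProbabilityMeasure.ne_zero _)
      (fun Q => (ht Q.2).1.2) (fun Q => (ht Q.2).2.2)
      (fun Q R hQR => (IsEnvErgodic.eq_or_mutuallySingular (ht Q.2).1 (ht R.2).1 (ht Q.2).2.1
        (ht R.2).2.1 (ht Q.2).2.2 (ht R.2).2.2).resolve_left fun h => hQR (Subtype.ext h))
    rw [Fintype.card_coe, hcard] at h
    omega
  have hmem : ∀ Q, Q ∈ hfin.toFinset ↔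
      IsEnvStationary Q ∧ IsEnvErgodic Q ∧ Q ≪ iidEnv ν := fun Q => hfin.mem_toFinset
  refine ⟨hfin.toFinset, hmem, fun Q hQ hac => ?_⟩
  have hprob := hQ.1
  obtain ⟨c, hc⟩ := exists_eq_sum_ergodic hfin.toFinset
    (fun R h1 h2 h3 => (hmem R).2 ⟨h1, h2, h3⟩) M Q inferInstance hQ.2 hac
    fun ι _ ρ h1 h2 h3 h4 h5 => hM ι ρ h1 h2 h3 (fun i => (h4 i).trans hac) h5
  refine ⟨c, ?_, hc⟩
  -- All measures in the sum have mass one, so the total mass of `Q` is the sum of the weights.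
  have h1 : Q Set.univ = 1 := measure_univ
  rw [hc, Measure.finsetSum_apply] at h1
  rw [← ENNReal.coe_inj, ENNReal.coe_one, ← h1, ENNReal.ofNNReal_finsetSum]
  refine Finset.sum_congr rfl fun R hR => ?_
  have := ((hmem R).1 hR).1.1
  rw [Measure.smul_apply, measure_univ, ENNReal.smul_def, smul_eq_mul, mul_one]
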